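/- Let $\mathcal A=\{A,B\}$ be a set of two parties with finite-dimensional Hilbert spaces $\mathcal H_A,\mathcal H_B$, and let $\rho=\rho_{AB}$ be a density operator on $\mathcal H_A\otimes\mathcal H_B$ with marginals (partial traces) $\rho_J$, $\varnothing\ne J\subseteq\mathcal A$. For $q>1$ let $S_q(J)=\frac{1}{1-q}(\operatorname{Tr}\rho_J^q-1)$ be the Tsallis entropy and $C_q(J)=\sum_{v\in J}S_q(\{v\})-S_q(J)$ the $q$-deformed total correlation, and let $$G_q(\varepsilon)=\{\varnothing\ne J\subseteq\mathcal A: C_q(J)\le\varepsilon\},\qquad \varepsilon\ge 0,$$ which is a filtration by simplicial complexes. Fix a field $K$ (for instance $\mathbb Z_2$) and use simplicial homology with coefficients in $K$. Let $\Delta_{\{A\}}$ be the complex whose only simplex is the vertex $\{A\}$, and for $k\ge 0$ put $$\beta_{q,k}^{\Delta_{\{A\}}}(\varepsilon)=\dim H_k\big(G_q(\varepsilon),\,G_q(\varepsilon)\cap\Delta_{\{A\}}\big),\qquad \widetilde\beta_{q,k}(\varepsilon)=\dim\widetilde H_k\big(G_q(\varepsilon)\big),$$ where $H_k(\cdot,\cdot)$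 is relative homology and $\widetilde H_k$ is reduced homology. The relative and the reduced integrated Euler characteristic are $$\mathfrak X_q^{\Delta_{\{A\}}}(\varepsilon)=\sum_{k\ge0}(-1)^k\int_0^{\varepsilon}\beta_{q,k}^{\Delta_{\{A\}}}(t)\,dt,\qquad \widetilde{\mathfrak X}_q(\varepsilon)=\sum_{k\ge0}(-1)^k\int_0^{\varepsilon}\widetilde\beta_{q,k}(t)\,dt .$$ Then for every $q>1$ the limits $\mathfrak X_q^{\Delta_{\{A\}}}(\infty)=\lim_{\varepsilon\to\infty}\mathfrak X_q^{\Delta_{\{A\}}}(\varepsilon)$ and $\widetilde{\mathfrak X}_q(\infty)=\lim_{\varepsilon\to\infty}\widetilde{\mathfrak X}_q(\varepsilon)$ exist and are finite, and $$\lim_{q\downarrow 1}\mathfrak X_q^{\Delta_{\{A\}}}(\infty)=\lim_{q\downarrow 1}\widetilde{\mathfrak X}_q(\infty)=I(A:B)_\rho\ge 0,$$ where $I(A:B)_\rho=S(\rho_A)+S(\rho_B)-S(\rho_{AB})$ is the mutual information and $S(\sigma)=-\operatorname{Tr}\sigma\log\sigma$ is the von Neumann entropy. -/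

import Mathlib

open scoped ComplexOrder

noncomputable section

namespace QPH

/-! ### Multipartite states, marginals and entropies -/

/-- Density matrices: positive semidefinite with unit trace. -/
def IsState {n : Type*} [Fintype n] (ρ : Matrix n n ℂ) : Prop :=
  ρ.PosSemidef ∧ ρ.trace = 1

/-- The marginal `ρ_J` of an operator on `⨂ i, ℂ^(d i)`: the partial trace over the parties
outside `J`. The basis of the tensor product is indexed by `∀ i, d i`. -/
def marginal {ι : Type*} [Fintype ι] [DecidableEq ι] {d : ι → Type*} [∀ i, Fintype (d i)]
    (ρ : Matrix (∀ i, d i) (∀ i, d i) ℂ) (J : Finset ι) :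
    Matrix (∀ i : {i // i ∈ J}, d i) (∀ i : {i // i ∈ J}, d i) ℂ :=
  fun x y => ∑ z : (∀ i : {i // i ∉ J}, d i),
    ρ ((Equiv.piEquivPiSubtypeProd (· ∈ J) d).symm (x, z))
      ((Equiv.piEquivPiSubtypeProd (· ∈ J) d).symm (y, z))

/-- Tsallis entropy `S_q(ρ) = (Tr ρ^q - 1) / (1 - q)`. -/
def tsallis {n : Type*} [Fintype n] [DecidableEq n] (q : ℝ) (ρ : Matrix n n ℂ) : ℝ :=
  (1 / (1 - q)) * ((cfc (fun x : ℝ => x ^ q) ρ).trace.re - 1)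

/-- Von Neumann entropy `S(ρ) = -Tr (ρ log ρ)` (natural logarithm, `0 log 0 = 0`). -/
def vonNeumann {n : Type*} [Fintype n] [DecidableEq n] (ρ : Matrix n n ℂ) : ℝ :=
  -(ρ * cfc Real.log ρ).trace.re

section Functionals

variable {ι : Type*} [Fintype ι] [DecidableEq ι] {d : ι → Type*} [∀ i, Fintype (d i)]
  [∀ i, DecidableEq (d i)]

/-- Mutual information `I(A:B) = S(A) + S(B) - S(AB)`. -/
def mutualInfo (ρ : Matrix (∀ i, d i) (∀ i, d i) ℂ) (A B : ι) : ℝ :=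
  vonNeumann (marginal ρ {A}) + vonNeumann (marginal ρ {B}) - vonNeumann (marginal ρ {A, B})

/-- The `q`-deformed total correlation `C_q(J) = ∑_{v ∈ J} S_q(v) - S_q(J)`. -/
def totalCorr (q : ℝ) (ρ : Matrix (∀ i, d i) (∀ i, d i) ℂ) (J : Finset ι) : ℝ :=
  ∑ v ∈ J, tsallis q (marginal ρ {v}) - tsallis q (marginal ρ J)

end Functionals

/-! ### Complexes and filtrations -/

/-- The sublevel filtration of a functional `F` on the nonempty subsets of `ι`. Its value at `ε` is
the largest simplicial complex all of whose faces `J` satisfy `F J ≤ ε`. If `F` is monotone, it is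
exactly `{J | F J ≤ ε}`, see `mem_sublevel_iff`; for the total correlation of two parties and
`0 ≤ ε` it is so in any case, see `mem_sublevel_totalCorr_iff`. -/
def sublevel {ι : Type*} (F : Finset ι → ℝ) (ε : ℝ) : PreAbstractSimplicialComplex ι where
  faces := {J | J.Nonempty ∧ ∀ I ⊆ J, I.Nonempty → F I ≤ ε}
  isRelLowerSet_faces := fun _ hJ =>
    ⟨hJ.1, fun _ hIJ hI => ⟨hI, fun _ hI' => hJ.2 _ (hI'.trans hIJ)⟩⟩

theorem mem_sublevel_iff {ι : Type*} (F : Finset ι → ℝ)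
    (hF : ∀ I J : Finset ι, I.Nonempty → I ⊆ J → F I ≤ F J) (ε : ℝ) (J : Finset ι) :
    J ∈ (sublevel F ε).faces ↔ J.Nonempty ∧ F J ≤ ε :=
  ⟨fun h => ⟨h.1, h.2 J subset_rfl h.1⟩, fun h => ⟨h.1, fun I hI hne => (hF I J hne hI).trans h.2⟩⟩

theorem mem_sublevel_totalCorr_iff {ι : Type*} [Fintype ι] [DecidableEq ι] {d : ι → Type*}
    [∀ i, Fintype (d i)] [∀ i, DecidableEq (d i)] (hι : Fintype.card ι = 2) (q : ℝ)
    (ρ : Matrix (∀ i, d i) (∀ i, d i) ℂ) {ε : ℝ} (hε : 0 ≤ ε) (J : Finset ι) :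
    J ∈ (sublevel (totalCorr q ρ) ε).faces ↔ J.Nonempty ∧ totalCorr q ρ J ≤ ε := by
  refine ⟨fun h => ⟨h.1, h.2 J subset_rfl h.1⟩, fun h => ⟨h.1, fun I hI hne => ?_⟩⟩
  rcases eq_or_ne I J with rfl | hIJ
  · exact h.2
  have h1 : I.card < J.card := Finset.card_lt_card (hI.ssubset_of_ne hIJ)
  have h2 : J.card ≤ 2 := hι ▸ Finset.card_le_univ J
  have h3 : 0 < I.card := hne.card_pos
  obtain ⟨v, rfl⟩ := Finset.card_eq_one.1 (show I.card = 1 by omega)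
  simpa [totalCorr] using hε

/-- The full simplex `Δ_S` on `S`: all nonempty subsets of `S`. -/
def fullSimplex {ι : Type*} (S : Finset ι) : PreAbstractSimplicialComplex ι where
  faces := {J | J.Nonempty ∧ J ⊆ S}
  isRelLowerSet_faces := fun _ hJ => ⟨hJ.1, fun _ hIJ hI => ⟨hI, hIJ.trans hJ.2⟩⟩

/-! ### Simplicial homology: reduced and relative -/

/-- The quotient `Z / B` of the cycles by the boundaries. -/
abbrev CyclesModBoundaries {K V : Type*} [Field K] [AddCommGroup V] [Module K V]
    (Z B : Submodule K V) : Type _ :=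
  Z ⧸ B.submoduleOf Z

section Homology

variable {ι : Type*} [LinearOrder ι] (K : Type*) [Field K]

/-- The `k`-simplices of a complex. -/
abbrev Simplex (G : PreAbstractSimplicialComplex ι) (k : ℕ) : Type _ :=
  {s : Finset ι // s ∈ G.faces ∧ s.card = k + 1}

/-- Simplicial `k`-chains with coefficients in `K`; a simplex is oriented by the order of `ι`. -/
abbrev Chain (G : PreAbstractSimplicialComplex ι) (k : ℕ) : Type _ :=
  Simplex G k →₀ K

/-- The face of a simplex obtained by omitting the vertex `v`. -/
def face {G : PreAbstractSimplicialComplex ι} {k : ℕ} (s : Simplex G (k + 1))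
    (v : {v // v ∈ s.1}) : Simplex G k :=
  ⟨s.1.erase v.1, by
    have hc : (s.1.erase v.1).card = k + 1 := by
      rw [Finset.card_erase_of_mem v.2, s.2.2]; rfl
    exact ⟨(G.isRelLowerSet_faces s.2.1).2 (Finset.erase_subset _ _)
      (Finset.card_pos.1 (by omega)), hc⟩⟩

/-- The boundary operator `∂ : C_{k+1} → C_k`, `∂ (v_0, …, v_{k+1}) = ∑ i, (-1)^i (…, v̂_i, …)`;
the position `i` of the vertex `v` is the number of smaller vertices of the simplex. -/
def boundary (G : PreAbstractSimplicialComplex ι) (k : ℕ) :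
    Chain K G (k + 1) →ₗ[K] Chain K G k :=
  Finsupp.linearCombination K fun s : Simplex G (k + 1) =>
    ∑ v : {v // v ∈ s.1},
      Finsupp.single (face s v) ((-1 : K) ^ (s.1.filter (· < v.1)).card)

/-- The augmentation `C_0 → K`, the sum of the coefficients. -/
def augmentation (G : PreAbstractSimplicialComplex ι) : Chain K G 0 →ₗ[K] K :=
  Finsupp.linearCombination K fun _ => (1 : K)

/-- Cycles of the augmented chain complex. -/
def redCycles (G : PreAbstractSimplicialComplex ι) : (k : ℕ) → Submodule K (Chain K G k)
  | 0 => LinearMap.ker (augmentation K G)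
  | k + 1 => LinearMap.ker (boundary K G k)

/-- Reduced homology in degree `k ≥ 0`. -/
abbrev redHomology (G : PreAbstractSimplicialComplex ι) (k : ℕ) : Type _ :=
  CyclesModBoundaries (redCycles K G k) (LinearMap.range (boundary K G k))

/-- Reduced Betti numbers. -/
def redBetti (G : PreAbstractSimplicialComplex ι) (k : ℕ) : ℕ :=
  Module.finrank K (redHomology K G k)

/-- The chains of a subcomplex `L` of `G`, inside the chains of `G`. -/
def subChain (G L : PreAbstractSimplicialComplex ι) (k : ℕ) : Submodule K (Chain K G k) :=
  Finsupp.supported K K {s | s.1 ∈ L.faces}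

/-- Relative chains `C_k(G) / C_k(L)`. -/
abbrev RelChain (G L : PreAbstractSimplicialComplex ι) (k : ℕ) : Type _ :=
  Chain K G k ⧸ subChain K G L k

theorem subChain_le_comap_boundary (G L : PreAbstractSimplicialComplex ι) (k : ℕ) :
    subChain K G L (k + 1) ≤ (subChain K G L k).comap (boundary K G k) := by
  rw [subChain, Finsupp.supported_eq_span_single, Submodule.span_le]
  rintro _ ⟨s, hs, rfl⟩
  simp only [Submodule.comap_coe, Set.mem_preimage, SetLike.mem_coe, boundary,
    Finsupp.linearCombination_single, one_smul]
  refine Submodule.sum_mem _ fun v _ => Finsupp.single_mem_supported K _ ?_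
  exact (L.isRelLowerSet_faces hs).2 (Finset.erase_subset _ _)
    ((G.isRelLowerSet_faces (face s v).2.1).1)

/-- The boundary operator induced on relative chains. -/
def relBoundary (G L : PreAbstractSimplicialComplex ι) (k : ℕ) :
    RelChain K G L (k + 1) →ₗ[K] RelChain K G L k :=
  Submodule.mapQ _ _ (boundary K G k) (subChain_le_comap_boundary K G L k)

/-- Relative cycles; every relative `0`-chain is a cycle. -/
def relCycles (G L : PreAbstractSimplicialComplex ι) : (k : ℕ) → Submodule K (RelChain K G L k)
  | 0 => ⊤
  | k + 1 => LinearMap.ker (relBoundary K G L k)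

/-- Relative homology `H_k(G, L)` for a subcomplex `L` of `G`. -/
abbrev relHomology (G L : PreAbstractSimplicialComplex ι) (k : ℕ) : Type _ :=
  CyclesModBoundaries (relCycles K G L k) (LinearMap.range (relBoundary K G L k))

/-- Relative Betti numbers. -/
def relBetti (G L : PreAbstractSimplicialComplex ι) (k : ℕ) : ℕ :=
  Module.finrank K (relHomology K G L k)

end Homology

/-! ### Topological summaries -/

/-- The integrated Betti number `𝔅_k(ε) = ∫_0^ε β_k(ε') dε'`. -/
def integratedBetti (β : ℝ → ℕ → ℕ) (k : ℕ) (ε : ℝ) : ℝ :=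
  ∫ t in (0 : ℝ)..ε, (β t k : ℝ)

/-- The integrated Euler characteristic `𝔛(ε) = ∑_{k ≥ 0} (-1)^k 𝔅_k(ε)` of a family of Betti
numbers (the sum is finite when the vertex set is finite). -/
def integratedEuler (β : ℝ → ℕ → ℕ) (ε : ℝ) : ℝ :=
  ∑' k : ℕ, (-1 : ℝ) ^ k * integratedBetti β k ε

section IEC

variable {ι : Type*} [Fintype ι] [LinearOrder ι] {d : ι → Type*} [∀ i, Fintype (d i)]
  [∀ i, DecidableEq (d i)] (K : Type*) [Field K]

/-- The reduced IEC at `ε` of the persistence complex of `C_q`. -/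
def redIEC (q : ℝ) (ρ : Matrix (∀ i, d i) (∀ i, d i) ℂ) (ε : ℝ) : ℝ :=
  integratedEuler (fun t => redBetti K (sublevel (totalCorr q ρ) t)) ε

/-- The IEC at `ε` of the persistence complex of `C_q`, relative to the full simplex `Δ_S`: it is
computed from `H_k(G(t), G(t) ∩ Δ_S)`. -/
def relIEC (q : ℝ) (ρ : Matrix (∀ i, d i) (∀ i, d i) ℂ) (S : Finset ι) (ε : ℝ) : ℝ :=
  integratedEuler
    (fun t => relBetti K (sublevel (totalCorr q ρ) t)
      (sublevel (totalCorr q ρ) t ⊓ fullSimplex S)) ε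

end IEC

end QPH

end

/-! On two parties, a singleton has total correlation `S_q(v) - S_q(v) = 0`, so both vertices are
present for every `t ≥ 0` and only the edge depends on `t`: it is present exactly when `C_q(AB) ≤
t`. Two points have one-dimensional reduced `H_0`, and also one-dimensional `H_0` relative to one of
them; with the edge both theories vanish in all degrees. Hence both integrated Euler characteristics
are constant, equal to `max (C_q(AB)) 0`, for large `ε` (`tendsto_integratedEuler`).

As `q ↓ 1`, `S_q` tends to the von Neumann entropy, being minus a difference quotient at `1` of `q ↦
Tr ρ^q` (`tendsto_tsallis`). So `C_q(AB)` tends to `I(A:B)`, and the positive part disappears in the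
limit because `I(A:B) ≥ 0`. Only the sign of the limit matters, so subadditivity of the Tsallis
entropy is not needed.

Nonnegativity is subadditivity of the von Neumann entropy (`vonNeumann_le_add`), reduced to the
classical case: in the product of the eigenbases of the two marginals, the diagonal of the state is
a joint distribution whose marginals are the spectra of `ρ_A` and `ρ_B`. Its Shannon entropy bounds
the entropy of the state from above. -/

namespace QPH

open Matrix MeasureTheory
open scoped Kronecker

/-! ### Entropies through eigenvalues, and the limit `q ↓ 1` -/

section Entropy

variable {n m : Type*} [Fintype n] [DecidableEq n] [Fintype m] [DecidableEq m]

theorem trace_cfc {M : Matrix n n ℂ} (hM : M.IsHermitian) (f : ℝ → ℝ) :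
    (cfc f M).trace.re = ∑ i, f (hM.eigenvalues i) := by
  rw [hM.cfc_eq, IsHermitian.cfc, Unitary.conjStarAlgAut_apply, trace_mul_comm, ← mul_assoc]
  simp [trace_diagonal]

theorem vonNeumann_eq_sum {M : Matrix n n ℂ} (hM : M.IsHermitian) :
    vonNeumann M = ∑ i, Real.negMulLog (hM.eigenvalues i) := by
  -- The spectrum is finite, so even `Real.log`, discontinuous at `0`, is continuous on it.
  have hc : ∀ f : ℝ → ℝ, ContinuousOn f (spectrum ℝ M) :=
    fun f => (Matrix.finite_real_spectrum (A := M)).continuousOn f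
  have h : M * cfc Real.log M = cfc (fun x : ℝ => x * Real.log x) M := by
    rw [cfc_mul (fun x : ℝ => x) Real.log M (hc _) (hc _),
      cfc_id' ℝ M hM.isSelfAdjoint]
  rw [vonNeumann, h, trace_cfc hM, ← Finset.sum_neg_distrib]
  simp [Real.negMulLog]

theorem IsState.sum_eigenvalues {M : Matrix n n ℂ} (hM : IsState M) :
    ∑ i, hM.1.1.eigenvalues i = 1 := by
  have h := hM.2.symm.trans hM.1.1.trace_eq_sum_eigenvalues
  simpa using (congrArg Complex.re h).symm

theorem hasDerivAt_const_rpow_one {x : ℝ} (hx : 0 ≤ x) :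
    HasDerivAt (fun q : ℝ => x ^ q) (-Real.negMulLog x) 1 := by
  -- For `x = 0` the function is constantly `0` near `q = 1`; its jump is at `q = 0`.
  rcases hx.eq_or_lt with rfl | hx
  · simp only [Real.negMulLog_zero, neg_zero]
    refine (hasDerivAt_const (1 : ℝ) (0 : ℝ)).congr_of_eventuallyEq ?_
    filter_upwards [isOpen_ne.mem_nhds (one_ne_zero : (1 : ℝ) ≠ 0)] with q hq
    exact Real.zero_rpow hq
  · simpa [Real.negMulLog] using (Real.hasStrictDerivAt_const_rpow hx 1).hasDerivAt

/-- The Tsallis entropy tends to the von Neumann entropy as `q ↓ 1`. -/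
theorem tendsto_tsallis {M : Matrix n n ℂ} (hM : IsState M) :
    Filter.Tendsto (fun q => tsallis q M) (nhdsWithin 1 (Set.Ioi 1)) (nhds (vonNeumann M)) := by
  have hd : HasDerivAt (fun q : ℝ => ∑ i, hM.1.1.eigenvalues i ^ q)
      (∑ i, -Real.negMulLog (hM.1.1.eigenvalues i)) 1 :=
    HasDerivAt.fun_sum fun i _ => hasDerivAt_const_rpow_one (hM.1.eigenvalues_nonneg i)
  have hs := (hasDerivAt_iff_tendsto_slope.1 hd).neg.mono_left
    (nhdsWithin_mono (1 : ℝ) (fun x (hx : 1 < x) => ne_of_gt hx))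
  rw [vonNeumann_eq_sum hM.1.1]
  simp only [Finset.sum_neg_distrib, neg_neg] at hs
  refine hs.congr fun q => ?_
  -- Since the eigenvalues sum to `1`, the Tsallis entropy is minus the slope between `1` and `q`.
  rw [tsallis, trace_cfc hM.1.1, slope_def_field]
  simp only [Real.rpow_one, hM.sum_eigenvalues]
  rw [← neg_sub q 1, one_div, inv_neg, div_eq_inv_mul]
  ring

/-- With `V = Uᴴ * W` and `U` an eigenbasis of `M`, the diagonal entries are averages of the
eigenvalues with weights `|V k i|²`. This weight matrix is doubly stochastic: column sums `1` allow
Jensen for the concave `negMulLog`, row sums `1` recover the entropy of `M` after summation. -/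
theorem vonNeumann_le_sum_negMulLog_diag {M : Matrix n n ℂ} (hM : M.PosSemidef)
    (W : Matrix n m ℂ) (hW : Wᴴ * W = 1) (hW' : W * Wᴴ = 1) :
    vonNeumann M ≤ ∑ i, Real.negMulLog ((Wᴴ * M * W) i i).re := by
  set U : Matrix n n ℂ := (hM.1.eigenvectorUnitary).1 with hU
  set l := hM.1.eigenvalues with hl
  have hUU : Uᴴ * U = 1 := Unitary.coe_star_mul_self hM.1.eigenvectorUnitary
  have hUU' : U * Uᴴ = 1 := Unitary.coe_mul_star_self hM.1.eigenvectorUnitary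
  have hspec : M = U * diagonal (fun i => (l i : ℂ)) * Uᴴ := by
    have := hM.1.spectral_theorem
    rwa [Unitary.conjStarAlgAut_apply] at this
  obtain ⟨V, hV⟩ : ∃ V : Matrix n m ℂ, V = Uᴴ * W := ⟨_, rfl⟩
  have hV1 : Vᴴ * V = 1 := by
    rw [hV, conjTranspose_mul, conjTranspose_conjTranspose, Matrix.mul_assoc,
      ← Matrix.mul_assoc U, hUU', Matrix.one_mul, hW]
  have hV2 : V * Vᴴ = 1 := by
    rw [hV, conjTranspose_mul, conjTranspose_conjTranspose, Matrix.mul_assoc,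
      ← Matrix.mul_assoc W, hW', Matrix.one_mul, hUU]
  have hcol : ∀ i, ∑ k, Complex.normSq (V k i) = 1 := fun i => by
    have := congrArg Complex.re (congrFun (congrFun hV1 i) i)
    simpa [Matrix.mul_apply, Complex.normSq_apply] using this
  have hrow : ∀ k, ∑ i, Complex.normSq (V k i) = 1 := fun k => by
    have := congrArg Complex.re (congrFun (congrFun hV2 k) k)
    simpa [Matrix.mul_apply, Complex.normSq_apply] using this
  have hdiag : ∀ i, ((Wᴴ * M * W) i i).re = ∑ k, Complex.normSq (V k i) * l k := fun i => by
    have : Wᴴ * M * W = Vᴴ * (diagonal (fun i => (l i : ℂ)) * V) := by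
      rw [hV, conjTranspose_mul, conjTranspose_conjTranspose]
      conv_lhs => rw [hspec]
      simp only [Matrix.mul_assoc]
    rw [this, Matrix.mul_apply, Complex.re_sum]
    refine Finset.sum_congr rfl fun k _ => ?_
    rw [diagonal_mul, conjTranspose_apply, mul_left_comm, mul_comm (Complex.normSq _),
      Complex.re_ofReal_mul, Complex.star_def, ← Complex.normSq_eq_conj_mul_self,
      Complex.ofReal_re]
  calc vonNeumann M = ∑ k, (∑ i, Complex.normSq (V k i)) * Real.negMulLog (l k) := by
        rw [vonNeumann_eq_sum hM.1]; simp [hrow, hl]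
    _ = ∑ i, ∑ k, Complex.normSq (V k i) * Real.negMulLog (l k) := by
        simp only [Finset.sum_mul]; exact Finset.sum_comm
    _ ≤ ∑ i, Real.negMulLog ((Wᴴ * M * W) i i).re := by
        refine Finset.sum_le_sum fun i _ => ?_
        rw [hdiag]
        exact Real.concaveOn_negMulLog.le_map_sum (fun k _ => Complex.normSq_nonneg _) (hcol i)
          (fun k _ => hM.eigenvalues_nonneg k)

end Entropy

/-! ### Subadditivity, classical and quantum -/

/-- Subadditivity of the Shannon entropy. -/
theorem sum_negMulLog_le_add {n m : Type*} [Fintype n] [Fintype m]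
    (p : n → m → ℝ) (hp : ∀ x y, 0 ≤ p x y)
    (hsum : ∑ x, ∑ y, p x y = 1) :
    ∑ x, ∑ y, Real.negMulLog (p x y) ≤
      ∑ x, Real.negMulLog (∑ y, p x y) + ∑ y, Real.negMulLog (∑ x, p x y) := by
  obtain ⟨a, ha⟩ : ∃ a : n → ℝ, ∀ x, ∑ y, p x y = a x := ⟨_, fun _ => rfl⟩
  obtain ⟨b, hb⟩ : ∃ b : m → ℝ, ∀ y, ∑ x, p x y = b y := ⟨_, fun _ => rfl⟩
  simp only [ha, hb]
  have hpa : ∀ x y, p x y ≤ a x := fun x y => ha x ▸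
    Finset.single_le_sum (f := fun y => p x y) (fun y _ => hp x y) (Finset.mem_univ y)
  have hpb : ∀ x y, p x y ≤ b y := fun x y => hb y ▸
    Finset.single_le_sum (f := fun x => p x y) (fun x _ => hp x y) (Finset.mem_univ x)
  have hbsum : ∑ y, b y = 1 := by
    rw [← hsum, Finset.sum_comm]; simp only [hb]
  -- This is `log t ≤ t - 1` at `t = a x * b y / p x y`, multiplied by `p x y`. The correction `a x
  -- * b y - p x y` sums to `1 - 1 = 0`.
  have key : ∀ x y, Real.negMulLog (p x y) ≤
      -(p x y * Real.log (a x)) - p x y * Real.log (b y) + (a x * b y - p x y) := fun x y => by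
    rcases (hp x y).eq_or_lt with h | h
    · rw [← h]
      simpa using mul_nonneg ((hp x y).trans (hpa x y)) ((hp x y).trans (hpb x y))
    · have h1 := h.trans_le (hpa x y)
      have h2 := h.trans_le (hpb x y)
      have h3 := Real.log_le_sub_one_of_pos (div_pos (mul_pos h1 h2) h)
      rw [Real.log_div (mul_pos h1 h2).ne' h.ne', Real.log_mul h1.ne' h2.ne'] at h3
      have h4 := mul_le_mul_of_nonneg_left h3 h.le
      have h5 : p x y * (a x * b y / p x y - 1) = a x * b y - p x y := by
        field_simp
      rw [h5] at h4
      rw [Real.negMulLog]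
      linarith
  have e1 : ∑ x, ∑ y, -(p x y * Real.log (a x)) = ∑ x, Real.negMulLog (a x) := by
    refine Finset.sum_congr rfl fun x _ => ?_
    rw [Finset.sum_neg_distrib, ← Finset.sum_mul, ha, Real.negMulLog, neg_mul]
  have e2 : ∑ x, ∑ y, p x y * Real.log (b y) = -∑ y, Real.negMulLog (b y) := by
    rw [Finset.sum_comm, ← Finset.sum_neg_distrib]
    refine Finset.sum_congr rfl fun y _ => ?_
    rw [← Finset.sum_mul, hb, Real.negMulLog, neg_mul, neg_neg]
  have e3 : ∑ x, ∑ y, a x * b y = 1 := by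
    simp only [← Finset.mul_sum, hbsum, mul_one, ← ha, hsum]
  calc _ ≤ ∑ x, ∑ y, (-(p x y * Real.log (a x)) - p x y * Real.log (b y)
        + (a x * b y - p x y)) :=
        Finset.sum_le_sum fun x _ => Finset.sum_le_sum fun y _ => key x y
    _ = _ := by
        simp only [Finset.sum_add_distrib, Finset.sum_sub_distrib, e1, e2, e3, hsum]
        ring

/-- Summing over `y` traces out the second factor, and a trace does not depend on the orthonormal
basis `V`; what remains is the partial trace of `R` in the basis `U`. -/
theorem sum_kronecker_conj_diag {n m : Type*} [Fintype n] [Fintype m] [DecidableEq m]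
    (R : Matrix (n × m) (n × m) ℂ) (U : Matrix n n ℂ)
    (V : Matrix m m ℂ) (hV : V * Vᴴ = 1) (x : n) :
    ∑ y, ((U ⊗ₖ V)ᴴ * R * (U ⊗ₖ V)) (x, y) (x, y) =
      (Uᴴ * of (fun s s' => ∑ t, R (s, t) (s', t)) * U) x x := by
  have hVV : ∀ t t', ∑ y, V t' y * star (V t y) = if t' = t then 1 else 0 := fun t t' => by
    have := congrFun (congrFun hV t') t
    simpa [Matrix.mul_apply, Matrix.one_apply] using this
  have h1 : ∀ y, ((U ⊗ₖ V)ᴴ * R * (U ⊗ₖ V)) (x, y) (x, y) =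
      ∑ s', ∑ t', ∑ s, ∑ t, star (U s x) * R (s, t) (s', t') * U s' x *
        (V t' y * star (V t y)) := fun y => by
    simp only [Matrix.mul_apply, Fintype.sum_prod_type, Finset.sum_mul, conjTranspose_apply,
      kronecker_apply, star_mul']
    refine Finset.sum_congr rfl fun s' _ => Finset.sum_congr rfl fun t' _ =>
      Finset.sum_congr rfl fun s _ => Finset.sum_congr rfl fun t _ => ?_
    ring
  simp only [h1]
  rw [Finset.sum_comm]
  simp only [Matrix.mul_apply, conjTranspose_apply, of_apply, Finset.sum_mul, Finset.mul_sum]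
  refine Finset.sum_congr rfl fun s' _ => ?_
  rw [Finset.sum_comm]
  calc _ = ∑ t', ∑ s, ∑ t, star (U s x) * R (s, t) (s', t') * U s' x *
        ∑ y, (V t' y * star (V t y)) := by
        refine Finset.sum_congr rfl fun t' _ => ?_
        rw [Finset.sum_comm]
        refine Finset.sum_congr rfl fun s _ => ?_
        rw [Finset.sum_comm]
        simp only [Finset.mul_sum]
    _ = _ := by
        simp only [hVV, mul_ite, mul_one, mul_zero, Finset.sum_ite_eq, Finset.mem_univ, if_true]
        exact Finset.sum_comm

section Subadditivity

variable {n m k : Type*} [Fintype n] [DecidableEq n] [Fintype m] [DecidableEq m]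
  [Fintype k] [DecidableEq k]

/-- An eigenbasis attains equality in `vonNeumann_le_sum_negMulLog_diag`. -/
theorem exists_unitary_vonNeumann_eq {M : Matrix n n ℂ} (hM : M.IsHermitian) :
    ∃ U : Matrix n n ℂ, Uᴴ * U = 1 ∧ U * Uᴴ = 1 ∧
      vonNeumann M = ∑ i, Real.negMulLog ((Uᴴ * M * U) i i).re := by
  refine ⟨hM.eigenvectorUnitary.1, Unitary.coe_star_mul_self hM.eigenvectorUnitary,
    Unitary.coe_mul_star_self hM.eigenvectorUnitary, ?_⟩
  rw [vonNeumann_eq_sum hM]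
  have h := hM.conjStarAlgAut_star_eigenvectorUnitary
  rw [Unitary.conjStarAlgAut_apply] at h
  have h' : (hM.eigenvectorUnitary.1)ᴴ * M * hM.eigenvectorUnitary.1 =
      diagonal (RCLike.ofReal ∘ hM.eigenvalues) := by
    simpa [star_eq_conjTranspose] using h
  rw [h']
  simp

/-- Subadditivity of the von Neumann entropy. -/
theorem vonNeumann_le_add {M : Matrix k k ℂ} (hM : IsState M) (e : n × m ≃ k)
    {MA : Matrix n n ℂ} {MB : Matrix m m ℂ} (hMA : MA.IsHermitian) (hMB : MB.IsHermitian)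
    (hA : ∀ x x', MA x x' = ∑ y, M (e (x, y)) (e (x', y)))
    (hB : ∀ y y', MB y y' = ∑ x, M (e (x, y)) (e (x, y'))) :
    vonNeumann M ≤ vonNeumann MA + vonNeumann MB := by
  obtain ⟨U, hU, hU', hUS⟩ := exists_unitary_vonNeumann_eq hMA
  obtain ⟨V, hV, hV', hVS⟩ := exists_unitary_vonNeumann_eq hMB
  set K := (U ⊗ₖ V) with hK
  have hKK : Kᴴ * K = 1 := by
    rw [hK, conjTranspose_kronecker, ← mul_kronecker_mul, hU, hV, one_kronecker_one]
  have hKK' : K * Kᴴ = 1 := by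
    rw [hK, conjTranspose_kronecker, ← mul_kronecker_mul, hU', hV', one_kronecker_one]
  -- The product basis, with its rows moved to the index type of `M` along `e`.
  set W : Matrix k (n × m) ℂ := K.submatrix e.symm id with hW
  set R : Matrix (n × m) (n × m) ℂ := M.submatrix e e with hR
  have hWW : Wᴴ * W = 1 := by
    rw [hW, conjTranspose_submatrix, submatrix_mul_equiv, hKK, submatrix_id_id]
  have hWW' : W * Wᴴ = 1 := by
    have : W * Wᴴ = (K * Kᴴ).submatrix e.symm e.symm := by
      rw [hW, conjTranspose_submatrix]
      exact submatrix_mul_equiv K Kᴴ e.symm (Equiv.refl _) e.symm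
    rw [this, hKK', submatrix_one_equiv]
  have hWR : Wᴴ * M * W = Kᴴ * R * K := by
    have : M = R.submatrix e.symm e.symm := by ext; simp [hR]
    rw [this, hW, conjTranspose_submatrix, submatrix_mul_equiv, submatrix_mul_equiv,
      submatrix_id_id]
  have hsum1 : ∀ x, ∑ y, ((Wᴴ * M * W) (x, y) (x, y)).re = ((Uᴴ * MA * U) x x).re := fun x => by
    rw [hWR, ← Complex.re_sum, hK, sum_kronecker_conj_diag R U V hV']
    have hMA' : MA = of (fun s s' => ∑ t, R (s, t) (s', t)) := by
      ext s s'
      simp [hA, hR]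
    rw [hMA']
  have hsum2 : ∀ y, ∑ x, ((Wᴴ * M * W) (x, y) (x, y)).re = ((Vᴴ * MB * V) y y).re := fun y => by
    -- The other marginal follows from the same lemma after swapping the tensor factors.
    have h := sum_kronecker_conj_diag (R.submatrix Prod.swap Prod.swap) V U hU' y
    have h2 : (V ⊗ₖ U)ᴴ * R.submatrix Prod.swap Prod.swap * (V ⊗ₖ U) =
        (Kᴴ * R * K).submatrix Prod.swap Prod.swap := by
      have h3 : (V ⊗ₖ U) = K.submatrix (Equiv.prodComm m n) (Equiv.prodComm m n) := by
        ext ⟨a, b⟩ ⟨c, d⟩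
        simp [hK, mul_comm]
      rw [h3, conjTranspose_submatrix]
      change _ * R.submatrix (Equiv.prodComm m n) (Equiv.prodComm m n) * _ = _
      rw [submatrix_mul_equiv, submatrix_mul_equiv]
      rfl
    rw [h2] at h
    rw [hWR, ← Complex.re_sum]
    have hMB' : MB = of (fun s s' => ∑ t, R.submatrix Prod.swap Prod.swap (s, t) (s', t)) := by
      ext s s'
      simp [hB, hR]
    rw [hMB']
    exact congrArg Complex.re h
  have hpos : ∀ x y, 0 ≤ ((Wᴴ * M * W) (x, y) (x, y)).re := fun x y =>
    (Complex.le_def.1 ((hM.1.conjTranspose_mul_mul_same W).diag_nonneg (i := (x, y)))).1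
  have htot : ∑ x, ∑ y, ((Wᴴ * M * W) (x, y) (x, y)).re = 1 := by
    have h1 : (Wᴴ * M * W).trace = 1 := by
      rw [trace_mul_comm, ← Matrix.mul_assoc, hWW', Matrix.one_mul, hM.2]
    have h2 := congrArg Complex.re h1
    rw [Matrix.trace, Complex.re_sum, Fintype.sum_prod_type] at h2
    simpa using h2
  have h := vonNeumann_le_sum_negMulLog_diag hM.1 W hWW hWW'
  rw [Fintype.sum_prod_type] at h
  refine h.trans ((sum_negMulLog_le_add _ hpos htot).trans_eq ?_)
  rw [hUS, hVS]
  simp only [hsum1, hsum2]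

end Subadditivity

/-! ### Marginals of a bipartite state -/

section Marginals

theorem mem_pair_of_parties {ι : Type*} [DecidableEq ι] {A B : ι}
    (hparties : ∀ i, i = A ∨ i = B) (i : ι) :
    i ∈ ({A, B} : Finset ι) := by
  simpa using hparties i

variable {ι : Type*} [Fintype ι] [DecidableEq ι] {d : ι → Type*} [∀ i, Fintype (d i)]

theorem IsState.marginal {ρ : Matrix (∀ i, d i) (∀ i, d i) ℂ} (hρ : IsState ρ) (J : Finset ι) :
    IsState (marginal ρ J) := by
  constructor
  -- A partial trace is a sum of principal submatrices, one for each basis state `z` of the parties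
  -- traced out.
  · have : QPH.marginal ρ J = ∑ z : (∀ i : {i // i ∉ J}, d i),
        ρ.submatrix (fun x => (Equiv.piEquivPiSubtypeProd (· ∈ J) d).symm (x, z))
          (fun x => (Equiv.piEquivPiSubtypeProd (· ∈ J) d).symm (x, z)) := by
      ext x y
      simp only [QPH.marginal, Matrix.sum_apply, submatrix_apply]
    rw [this]
    exact posSemidef_sum _ fun z _ => hρ.1.submatrix _
  · rw [← hρ.2]
    simp only [Matrix.trace, diag_apply, QPH.marginal]
    rw [← Fintype.sum_prod_type (fun p => ρ ((Equiv.piEquivPiSubtypeProd (· ∈ J) d).symm p)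
      ((Equiv.piEquivPiSubtypeProd (· ∈ J) d).symm p))]
    exact Equiv.sum_comp (Equiv.piEquivPiSubtypeProd (· ∈ J) d).symm (fun f => ρ f f)

/-- Splitting a function on `{A, B}` into its values at `A` and at `B`. -/
def pairEquiv {A B : ι} (hAB : A ≠ B) :
    ((∀ i : {i // i ∈ ({A} : Finset ι)}, d i) × (∀ i : {i // i ∈ ({B} : Finset ι)}, d i)) ≃
      (∀ i : {i // i ∈ ({A, B} : Finset ι)}, d i) where
  toFun p i := if h : i.1 ∈ ({A} : Finset ι) then p.1 ⟨i.1, h⟩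
    else p.2 ⟨i.1, (Finset.mem_insert.1 i.2).resolve_left (mt Finset.mem_singleton.2 h)⟩
  invFun f := (fun i => f ⟨i.1, Finset.mem_insert.2 (.inl (Finset.mem_singleton.1 i.2))⟩,
    fun i => f ⟨i.1, Finset.mem_insert.2 (.inr i.2)⟩)
  left_inv p := by
    refine Prod.ext ?_ ?_
    · funext i
      exact dif_pos i.2
    · funext i
      have h : i.1 ∉ ({A} : Finset ι) := by
        have := i.2
        simp only [Finset.mem_singleton] at this ⊢
        rw [this]
        exact hAB.symm
      exact dif_neg h
  right_inv f := by
    funext i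
    by_cases h : i.1 ∈ ({A} : Finset ι) <;> simp [h]

theorem marginal_pair {A B : ι} (hparties : ∀ i, i = A ∨ i = B)
    (ρ : Matrix (∀ i, d i) (∀ i, d i) ℂ) (f g : ∀ i : {i // i ∈ ({A, B} : Finset ι)}, d i) :
    marginal ρ {A, B} f g = ρ (fun i => f ⟨i, mem_pair_of_parties hparties i⟩)
      (fun i => g ⟨i, mem_pair_of_parties hparties i⟩) := by
  have : IsEmpty {i // i ∉ ({A, B} : Finset ι)} := ⟨fun i => i.2 (mem_pair_of_parties hparties _)⟩
  have hf : ∀ (f : ∀ i : {i // i ∈ ({A, B} : Finset ι)}, d i) z,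
      (Equiv.piEquivPiSubtypeProd (· ∈ ({A, B} : Finset ι)) d).symm (f, z) =
        fun i => f ⟨i, mem_pair_of_parties hparties i⟩ := fun f z => by
    funext i
    exact dif_pos (mem_pair_of_parties hparties i)
  simp only [marginal, hf, Fintype.sum_unique]

theorem marginal_left_eq_sum {A B : ι} (hAB : A ≠ B) (hparties : ∀ i, i = A ∨ i = B)
    (ρ : Matrix (∀ i, d i) (∀ i, d i) ℂ) (x x' : ∀ i : {i // i ∈ ({A} : Finset ι)}, d i) :
    marginal ρ {A} x x' =
      ∑ y, marginal ρ {A, B} (pairEquiv hAB (x, y)) (pairEquiv hAB (x', y)) := by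
  have h1 : ∀ {i}, i ∉ ({A} : Finset ι) → i ∈ ({B} : Finset ι) := fun {i} h =>
    Finset.mem_singleton.2 ((hparties i).resolve_left (mt Finset.mem_singleton.2 h))
  have h2 : ∀ {i}, i ∈ ({B} : Finset ι) → i ∉ ({A} : Finset ι) := fun {i} h h' =>
    hAB ((Finset.mem_singleton.1 h').symm.trans (Finset.mem_singleton.1 h))
  let e : (∀ i : {i // i ∉ ({A} : Finset ι)}, d i) ≃ (∀ i : {i // i ∈ ({B} : Finset ι)}, d i) :=
    { toFun := fun z i => z ⟨i.1, h2 i.2⟩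
      invFun := fun y i => y ⟨i.1, h1 i.2⟩
      left_inv := fun _ => rfl
      right_inv := fun _ => rfl }
  simp only [marginal_pair hparties]
  exact Fintype.sum_equiv e _ _ fun z => rfl

theorem marginal_right_eq_sum {A B : ι} (hAB : A ≠ B) (hparties : ∀ i, i = A ∨ i = B)
    (ρ : Matrix (∀ i, d i) (∀ i, d i) ℂ) (y y' : ∀ i : {i // i ∈ ({B} : Finset ι)}, d i) :
    marginal ρ {B} y y' =
      ∑ x, marginal ρ {A, B} (pairEquiv hAB (x, y)) (pairEquiv hAB (x, y')) := by
  have hsymm : ∀ i, i = B ∨ i = A := fun i => (hparties i).symm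
  have hglue : ∀ (x : ∀ i : {i // i ∈ ({A} : Finset ι)}, d i)
      (y : ∀ i : {i // i ∈ ({B} : Finset ι)}, d i),
      -- Gluing in either order gives the same global index, so the roles of `A` and `B` can be
      -- exchanged.
      (fun i => pairEquiv hAB.symm (y, x) ⟨i, mem_pair_of_parties hsymm i⟩) =
        fun i => pairEquiv hAB (x, y) ⟨i, mem_pair_of_parties hparties i⟩ := fun x y => by
    funext i
    rcases hparties i with rfl | rfl <;> simp [pairEquiv, hAB, hAB.symm]
  rw [marginal_left_eq_sum hAB.symm hsymm]
  simp only [marginal_pair hparties, marginal_pair hsymm, hglue]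

variable [∀ i, DecidableEq (d i)]

theorem mutualInfo_nonneg {A B : ι} (hAB : A ≠ B) (hparties : ∀ i, i = A ∨ i = B)
    {ρ : Matrix (∀ i, d i) (∀ i, d i) ℂ} (hρ : IsState ρ) : 0 ≤ mutualInfo ρ A B :=
  sub_nonneg.2 <| vonNeumann_le_add (hρ.marginal {A, B}) (pairEquiv hAB) (hρ.marginal {A}).1.1
    (hρ.marginal {B}).1.1 (marginal_left_eq_sum hAB hparties ρ)
    (marginal_right_eq_sum hAB hparties ρ)

theorem tendsto_totalCorr_pair {A B : ι} (hAB : A ≠ B)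
    {ρ : Matrix (∀ i, d i) (∀ i, d i) ℂ} (hρ : IsState ρ) :
    Filter.Tendsto (fun q => totalCorr q ρ {A, B}) (nhdsWithin 1 (Set.Ioi 1))
      (nhds (mutualInfo ρ A B)) := by
  simp only [totalCorr, Finset.sum_pair hAB]
  exact ((tendsto_tsallis (hρ.marginal {A})).add (tendsto_tsallis (hρ.marginal {B}))).sub
    (tendsto_tsallis (hρ.marginal {A, B}))

end Marginals

/-! ### Dimension of cycles modulo boundaries -/

section LinearAlgebra

variable {K V : Type*} [Field K] [AddCommGroup V] [Module K V] {Z B : Submodule K V}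

theorem finrank_cyclesModBoundaries_eq_zero (h : Z ≤ B) :
    Module.finrank K (CyclesModBoundaries Z B) = 0 := by
  have : Subsingleton (CyclesModBoundaries Z B) :=
    Submodule.Quotient.subsingleton_iff.2 (Submodule.submoduleOf_eq_top.2 h)
  exact Module.finrank_zero_of_subsingleton

theorem finrank_cyclesModBoundaries_eq_one (hB : B = ⊥) (z : V) (hz : z ∈ Z) (hne : z ≠ 0)
    (hspan : ∀ w ∈ Z, ∃ r : K, r • z = w) :
    Module.finrank K (CyclesModBoundaries Z B) = 1 := by
  have hB' : B.submoduleOf Z = ⊥ := by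
    subst hB
    exact Submodule.ker_subtype Z
  rw [(Submodule.quotEquivOfEqBot _ hB').finrank_eq]
  refine finrank_eq_one_iff'.2 ⟨⟨z, hz⟩, fun h => hne (congrArg Subtype.val h), fun w => ?_⟩
  obtain ⟨r, hr⟩ := hspan w w.2
  exact ⟨r, Subtype.ext hr⟩

end LinearAlgebra

/-! ### Homology of a complex on two vertices -/

section Vertices

variable {ι : Type*} (K : Type*) [Field K] {G : PreAbstractSimplicialComplex ι} {A B : ι}

/-- A vertex of a complex as a simplex. -/
def vertex (v : ι) (hv : {v} ∈ G.faces) : Simplex G 0 := ⟨{v}, hv, Finset.card_singleton v⟩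

theorem vertex_ne (hAB : A ≠ B) (hA : {A} ∈ G.faces) (hB : {B} ∈ G.faces) :
    vertex A hA ≠ vertex B hB := fun h =>
  hAB (Finset.singleton_injective (congrArg Subtype.val h))

theorem single_vertex_mem_subChain (hA : {A} ∈ G.faces) (r : K) :
    Finsupp.single (vertex A hA) r ∈ subChain K G (G ⊓ fullSimplex {A}) 0 :=
  Finsupp.single_mem_supported K r ⟨hA, Finset.singleton_nonempty A, subset_rfl⟩

theorem apply_vertex_of_mem_subChain (hAB : A ≠ B) (hB : {B} ∈ G.faces) {c : Chain K G 0}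
    (hc : c ∈ subChain K G (G ⊓ fullSimplex {A}) 0) : c (vertex B hB) = 0 := by
  refine (Finsupp.mem_supported' K c).1 hc _ fun h => ?_
  exact hAB (Finset.singleton_subset_singleton.1 h.2.2).symm

theorem zero_chain_eq (hAB : A ≠ B) (hparties : ∀ i, i = A ∨ i = B) (hA : {A} ∈ G.faces)
    (hB : {B} ∈ G.faces) (c : Chain K G 0) :
    c = Finsupp.single (vertex A hA) (c (vertex A hA)) +
      Finsupp.single (vertex B hB) (c (vertex B hB)) := by
  have hne := vertex_ne hAB hA hB
  ext s
  have hs : s = vertex A hA ∨ s = vertex B hB := by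
    obtain ⟨v, hv⟩ := Finset.card_eq_one.1 s.2.2
    rcases hparties v with rfl | rfl
    · exact .inl (Subtype.ext hv)
    · exact .inr (Subtype.ext hv)
  rcases hs with rfl | rfl <;> simp [hne, hne.symm]

/-- Together with `apply_vertex_of_mem_subChain`, this identifies the relative `0`-chains with the
line spanned by the class of `B`. -/
theorem sub_single_mem_subChain (hAB : A ≠ B) (hparties : ∀ i, i = A ∨ i = B)
    (hA : {A} ∈ G.faces) (hB : {B} ∈ G.faces) (c : Chain K G 0) :
    c - Finsupp.single (vertex B hB) (c (vertex B hB)) ∈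
      subChain K G (G ⊓ fullSimplex {A}) 0 := by
  rw [sub_eq_of_eq_add (zero_chain_eq K hAB hparties hA hB c)]
  exact single_vertex_mem_subChain K hA _

theorem augmentation_apply (hAB : A ≠ B) (hparties : ∀ i, i = A ∨ i = B) (hA : {A} ∈ G.faces)
    (hB : {B} ∈ G.faces) (c : Chain K G 0) :
    augmentation K G c = c (vertex A hA) + c (vertex B hB) := by
  conv_lhs => rw [zero_chain_eq K hAB hparties hA hB c]
  simp [augmentation]

end Vertices

section TwoVertices

variable {ι : Type*} [LinearOrder ι] (K : Type*) [Field K] {G : PreAbstractSimplicialComplex ι}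
  {A B : ι}

theorem isEmpty_simplex_add_two (hparties : ∀ i, i = A ∨ i = B) (k : ℕ) :
    IsEmpty (Simplex G (k + 2)) := by
  refine ⟨fun s => ?_⟩
  have h : s.1 ⊆ {A, B} := fun i _ => mem_pair_of_parties hparties i
  have := (Finset.card_le_card h).trans Finset.card_le_two
  have := s.2.2
  omega

theorem Simplex.eq_pair (hparties : ∀ i, i = A ∨ i = B) (s : Simplex G 1) : s.1 = {A, B} :=
  Finset.eq_of_subset_of_card_le (fun i _ => mem_pair_of_parties hparties i)
    (Finset.card_le_two.trans_eq s.2.2.symm)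

theorem isEmpty_simplex_one (hparties : ∀ i, i = A ∨ i = B) (hG : {A, B} ∉ G.faces) :
    IsEmpty (Simplex G 1) :=
  ⟨fun s => hG (s.eq_pair hparties ▸ s.2.1)⟩

theorem isEmpty_simplex_succ (hparties : ∀ i, i = A ∨ i = B) (hG : {A, B} ∉ G.faces) :
    ∀ k, IsEmpty (Simplex G (k + 1))
  | 0 => isEmpty_simplex_one hparties hG
  | k + 1 => isEmpty_simplex_add_two hparties k

/-- The edge joining two vertices as a simplex. -/
def edge (hAB : A ≠ B) (he : {A, B} ∈ G.faces) : Simplex G 1 := ⟨{A, B}, he, Finset.card_pair hAB⟩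

theorem one_chain_eq (hAB : A ≠ B) (hparties : ∀ i, i = A ∨ i = B) (he : {A, B} ∈ G.faces)
    (c : Chain K G 1) : c = Finsupp.single (edge hAB he) (c (edge hAB he)) := by
  ext s
  have hs : s = edge hAB he := Subtype.ext (s.eq_pair hparties)
  simp [hs]

/-- The unit `u` is the orientation sign, `1` if `A < B` and `-1` otherwise. Only `u ≠ 0` matters
later, which removes any assumption on the order of the vertices. -/
theorem exists_boundary_edge (hAB : A ≠ B) (hA : {A} ∈ G.faces) (hB : {B} ∈ G.faces)
    (he : {A, B} ∈ G.faces) : ∃ u : K, u ≠ 0 ∧ ∀ r : K,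
      boundary K G 0 (Finsupp.single (edge hAB he) r) =
        Finsupp.single (vertex B hB) (r * u) - Finsupp.single (vertex A hA) (r * u) := by
  have hmA : A ∈ (edge hAB he).1 := Finset.mem_insert_self A {B}
  have hmB : B ∈ (edge hAB he).1 := Finset.mem_insert_of_mem (Finset.mem_singleton_self B)
  have hfA : face (edge hAB he) ⟨A, hmA⟩ = vertex B hB :=
    Subtype.ext (Finset.erase_insert (by simpa using hAB))
  have hfB : face (edge hAB he) ⟨B, hmB⟩ = vertex A hA := by
    refine Subtype.ext ?_
    change ({A, B} : Finset ι).erase B = {A}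
    rw [Finset.pair_comm]
    exact Finset.erase_insert (by simpa using hAB.symm)
  have hsum : ∀ r : K, boundary K G 0 (Finsupp.single (edge hAB he) r) =
      r • (Finsupp.single (vertex B hB) ((-1 : K) ^ (({A, B} : Finset ι).filter (· < A)).card) +
        Finsupp.single (vertex A hA) ((-1 : K) ^ (({A, B} : Finset ι).filter (· < B)).card)) := by
    intro r
    rw [boundary, Finsupp.linearCombination_single,
      Fintype.sum_eq_add (⟨A, hmA⟩ : {v // v ∈ (edge hAB he).1}) ⟨B, hmB⟩
        (fun h => hAB (congrArg Subtype.val h)), hfA, hfB]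
    · rfl
    · rintro ⟨v, hv⟩ ⟨h1, h2⟩
      rcases Finset.mem_insert.1 hv with rfl | hv
      · exact absurd rfl h1
      · exact absurd (Subtype.ext (Finset.mem_singleton.1 hv)) h2
  rcases hAB.lt_or_gt with h | h
  · refine ⟨1, one_ne_zero, fun r => ?_⟩
    rw [hsum]
    simp [Finset.filter_insert, Finset.filter_singleton, h, h.not_gt, sub_eq_add_neg]
  · refine ⟨-1, neg_ne_zero.2 one_ne_zero, fun r => ?_⟩
    rw [hsum]
    simp [Finset.filter_insert, Finset.filter_singleton, h, h.not_gt, sub_eq_add_neg]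

/-- Without edges there are no boundaries, and the kernel of the augmentation is spanned by `B - A`.
-/
theorem redBetti_zero_of_pair_notMem (hAB : A ≠ B) (hparties : ∀ i, i = A ∨ i = B)
    (hA : {A} ∈ G.faces) (hB : {B} ∈ G.faces) (he : {A, B} ∉ G.faces) : redBetti K G 0 = 1 := by
  have := isEmpty_simplex_one hparties he
  have hne := vertex_ne hAB hA hB
  have hbot : LinearMap.range (boundary K G 0) = ⊥ :=
    LinearMap.range_eq_bot.2 (Subsingleton.elim _ _)
  refine finrank_cyclesModBoundaries_eq_one hbot
    (Finsupp.single (vertex B hB) 1 - Finsupp.single (vertex A hA) 1)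
    (LinearMap.mem_ker.2 (by simp [augmentation])) (fun h => ?_) fun c hc => ?_
  · have h1 := DFunLike.congr_fun h (vertex B hB)
    simp [hne] at h1
  · refine ⟨c (vertex B hB), ?_⟩
    replace hc : augmentation K G c = 0 := hc
    rw [augmentation_apply K hAB hparties hA hB] at hc
    conv_rhs => rw [zero_chain_eq K hAB hparties hA hB c, eq_neg_of_add_eq_zero_left hc]
    simp [sub_eq_add_neg, add_comm]

theorem redBetti_succ_of_pair_notMem (hparties : ∀ i, i = A ∨ i = B) (he : {A, B} ∉ G.faces)
    (k : ℕ) : redBetti K G (k + 1) = 0 := by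
  have := isEmpty_simplex_succ hparties he k
  exact finrank_cyclesModBoundaries_eq_zero fun c _ => by
    rw [Subsingleton.elim c 0]; exact zero_mem _

/-- The edge bounds `u • (B - A)` with `u ≠ 0`: this kills the class of `B - A` in degree `0` and
makes the boundary injective in degree `1`. Higher simplices do not exist. -/
theorem redBetti_of_pair_mem (hAB : A ≠ B) (hparties : ∀ i, i = A ∨ i = B)
    (he : {A, B} ∈ G.faces) (k : ℕ) : redBetti K G k = 0 := by
  have hA : {A} ∈ G.faces := (G.isRelLowerSet_faces he).2 (by simp) (Finset.singleton_nonempty A)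
  have hB : {B} ∈ G.faces := (G.isRelLowerSet_faces he).2 (by simp) (Finset.singleton_nonempty B)
  obtain ⟨u, hu, hd⟩ := exists_boundary_edge K hAB hA hB he
  have hne := vertex_ne hAB hA hB
  refine finrank_cyclesModBoundaries_eq_zero ?_
  match k with
  | 0 =>
    intro c hc
    replace hc : augmentation K G c = 0 := hc
    rw [augmentation_apply K hAB hparties hA hB] at hc
    refine ⟨Finsupp.single (edge hAB he) (c (vertex B hB) * u⁻¹), ?_⟩
    rw [hd, inv_mul_cancel_right₀ hu]
    conv_rhs => rw [zero_chain_eq K hAB hparties hA hB c, eq_neg_of_add_eq_zero_left hc]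
    simp [sub_eq_add_neg, add_comm]
  | 1 =>
    intro c hc
    replace hc : boundary K G 0 c = 0 := hc
    rw [one_chain_eq K hAB hparties he c, hd] at hc
    have h1 := DFunLike.congr_fun hc (vertex B hB)
    simp only [Finsupp.coe_sub, Pi.sub_apply, Finsupp.single_eq_same, Finsupp.coe_zero,
      Pi.zero_apply, Finsupp.single_eq_of_ne hne.symm, sub_zero] at h1
    rw [one_chain_eq K hAB hparties he c, (mul_eq_zero.1 h1).resolve_right hu, Finsupp.single_zero]
    exact zero_mem _
  | k + 2 =>
    have := isEmpty_simplex_add_two (G := G) hparties k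
    intro c _
    rw [Subsingleton.elim c 0]
    exact zero_mem _

theorem relBetti_zero_of_pair_notMem (hAB : A ≠ B) (hparties : ∀ i, i = A ∨ i = B)
    (hA : {A} ∈ G.faces) (hB : {B} ∈ G.faces) (he : {A, B} ∉ G.faces) :
    relBetti K G (G ⊓ fullSimplex {A}) 0 = 1 := by
  have := isEmpty_simplex_one hparties he
  have hbot : LinearMap.range (relBoundary K G (G ⊓ fullSimplex {A}) 0) = ⊥ := by
    refine LinearMap.range_eq_bot.2 (LinearMap.ext fun c => ?_)
    obtain ⟨c, rfl⟩ := Submodule.Quotient.mk_surjective _ c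
    rw [Subsingleton.elim c 0, Submodule.Quotient.mk_zero, map_zero, map_zero]
  refine finrank_cyclesModBoundaries_eq_one hbot
    (Submodule.Quotient.mk (Finsupp.single (vertex B hB) 1)) Submodule.mem_top (fun h => ?_)
    fun c _ => ?_
  · have h1 := apply_vertex_of_mem_subChain K hAB hB ((Submodule.Quotient.mk_eq_zero _).1 h)
    simp at h1
  · obtain ⟨c, rfl⟩ := Submodule.Quotient.mk_surjective _ c
    refine ⟨c (vertex B hB), ?_⟩
    rw [← Submodule.Quotient.mk_smul]
    refine ((Submodule.Quotient.eq _).2 ?_).symm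
    simpa using sub_single_mem_subChain K hAB hparties hA hB c

theorem relBetti_eq_zero_of_isEmpty (L : PreAbstractSimplicialComplex ι) {k : ℕ}
    (h : IsEmpty (Simplex G k)) : relBetti K G L k = 0 := by
  refine finrank_cyclesModBoundaries_eq_zero fun c _ => ?_
  obtain ⟨c, rfl⟩ := Submodule.Quotient.mk_surjective _ c
  rw [Subsingleton.elim c 0]
  exact zero_mem _

/-- Modulo `A`, the boundary sends the edge to `u • B`, so it is an isomorphism between the lines of
relative `1`-chains and relative `0`-chains. -/
theorem relBetti_of_pair_mem (hAB : A ≠ B) (hparties : ∀ i, i = A ∨ i = B)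
    (he : {A, B} ∈ G.faces) (k : ℕ) : relBetti K G (G ⊓ fullSimplex {A}) k = 0 := by
  have hA : {A} ∈ G.faces := (G.isRelLowerSet_faces he).2 (by simp) (Finset.singleton_nonempty A)
  have hB : {B} ∈ G.faces := (G.isRelLowerSet_faces he).2 (by simp) (Finset.singleton_nonempty B)
  obtain ⟨u, hu, hd⟩ := exists_boundary_edge K hAB hA hB he
  have hne := vertex_ne hAB hA hB
  match k with
  | 0 =>
    refine finrank_cyclesModBoundaries_eq_zero fun c _ => ?_
    obtain ⟨c, rfl⟩ := Submodule.Quotient.mk_surjective _ c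
    refine ⟨Submodule.Quotient.mk (Finsupp.single (edge hAB he) (c (vertex B hB) * u⁻¹)), ?_⟩
    change Submodule.Quotient.mk (boundary K G 0 _) = _
    rw [hd, inv_mul_cancel_right₀ hu]
    refine (Submodule.Quotient.eq _).2 ?_
    -- Boundary minus `c` is rearranged as `-(c - c_B • B) - c_B • A`, where `c_B` is the
    -- coefficient of `c` at `B`; both terms are chains on `A`.
    rw [sub_right_comm, ← neg_sub c]
    exact sub_mem (neg_mem (sub_single_mem_subChain K hAB hparties hA hB c))
      (single_vertex_mem_subChain K hA _)
  | 1 =>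
    refine finrank_cyclesModBoundaries_eq_zero fun c hc => ?_
    obtain ⟨c, rfl⟩ := Submodule.Quotient.mk_surjective _ c
    replace hc : Submodule.Quotient.mk (boundary K G 0 c) = 0 := hc
    have h1 := apply_vertex_of_mem_subChain K hAB hB ((Submodule.Quotient.mk_eq_zero _).1 hc)
    rw [one_chain_eq K hAB hparties he c, hd] at h1
    simp only [Finsupp.coe_sub, Pi.sub_apply, Finsupp.single_eq_same,
      Finsupp.single_eq_of_ne hne.symm, sub_zero] at h1
    rw [one_chain_eq K hAB hparties he c, (mul_eq_zero.1 h1).resolve_right hu, Finsupp.single_zero]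
    exact zero_mem _
  | k + 2 => exact relBetti_eq_zero_of_isEmpty K _ (isEmpty_simplex_add_two hparties k)

end TwoVertices

/-! ### Integrated Euler characteristics -/

/-- If the homology at `t ≥ 0` is one-dimensional in degree `0` for `t < C`, and vanishes
otherwise, then the integrated Euler characteristic tends to `max C 0`. -/
theorem tendsto_integratedEuler (β : ℝ → ℕ → ℕ) (C : ℝ)
    (h0 : ∀ t, 0 ≤ t → t < C → β t 0 = 1) (h0' : ∀ t, 0 ≤ t → C ≤ t → β t 0 = 0)
    (hsucc : ∀ t k, 0 ≤ t → β t (k + 1) = 0) :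
    Filter.Tendsto (integratedEuler β) Filter.atTop (nhds (max C 0)) := by
  -- The function is constant from `ε = max C 0` on.
  refine tendsto_const_nhds.congr' ?_
  filter_upwards [Filter.eventually_ge_atTop (max C 0)] with ε hε
  have hε0 : 0 ≤ ε := (le_max_right C 0).trans hε
  have hεC : C ≤ ε := (le_max_left C 0).trans hε
  have hk : ∀ k, k ≠ 0 → (-1 : ℝ) ^ k * integratedBetti β k ε = 0 := fun k hk => by
    obtain ⟨k, rfl⟩ := Nat.exists_eq_succ_of_ne_zero hk
    rw [integratedBetti, intervalIntegral.integral_congr (g := fun _ => (0 : ℝ)),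
      intervalIntegral.integral_zero, mul_zero]
    intro t ht
    rw [Set.uIcc_of_le hε0] at ht
    simp [hsucc t k ht.1]
  rw [integratedEuler, tsum_eq_single 0 hk, pow_zero, one_mul, integratedBetti,
    intervalIntegral.integral_congr (g := (Set.Iio C).indicator fun _ => (1 : ℝ))]
  · rw [intervalIntegral.integral_of_le hε0, setIntegral_indicator measurableSet_Iio]
    have hset : Set.Ioc 0 ε ∩ Set.Iio C = Set.Ioo 0 C := by
      ext t
      exact ⟨fun h => ⟨h.1.1, h.2⟩, fun h => ⟨⟨h.1, h.2.le.trans hεC⟩, h.2⟩⟩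
    -- For `C < 0` the interval is empty; truncation in `ENNReal.ofReal` produces the maximum with
    -- `0`.
    rw [hset, setIntegral_const, smul_eq_mul, mul_one, Measure.real, Real.volume_Ioo, sub_zero,
      ENNReal.toReal_ofReal']
  · intro t ht
    rw [Set.uIcc_of_le hε0] at ht
    rcases lt_or_ge t C with h | h
    · simp [h0 t ht.1 h, h]
    · simp [h0' t ht.1 h, h]

section IEC

variable {ι : Type*} [Fintype ι] [LinearOrder ι] {d : ι → Type*} [∀ i, Fintype (d i)]
  [∀ i, DecidableEq (d i)] (K : Type*) [Field K] {A B : ι}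

theorem singleton_mem_sublevel_totalCorr (q : ℝ) (ρ : Matrix (∀ i, d i) (∀ i, d i) ℂ) {t : ℝ}
    (ht : 0 ≤ t) (v : ι) : {v} ∈ (sublevel (totalCorr q ρ) t).faces := by
  refine ⟨Finset.singleton_nonempty v, fun I hI hne => ?_⟩
  rw [hne.subset_singleton_iff.1 hI]
  simpa [totalCorr] using ht

theorem pair_mem_sublevel_totalCorr_iff (hAB : A ≠ B) (hparties : ∀ i, i = A ∨ i = B) (q : ℝ)
    (ρ : Matrix (∀ i, d i) (∀ i, d i) ℂ) {t : ℝ} (ht : 0 ≤ t) :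
    {A, B} ∈ (sublevel (totalCorr q ρ) t).faces ↔ totalCorr q ρ {A, B} ≤ t := by
  have hcard : Fintype.card ι = 2 := by
    rw [← Finset.card_univ, ← Finset.card_pair hAB]
    congr 1
    exact (Finset.eq_univ_of_forall (mem_pair_of_parties hparties)).symm
  rw [mem_sublevel_totalCorr_iff hcard q ρ ht]
  exact and_iff_right (Finset.insert_nonempty A {B})

theorem tendsto_redIEC (hAB : A ≠ B) (hparties : ∀ i, i = A ∨ i = B) (q : ℝ)
    (ρ : Matrix (∀ i, d i) (∀ i, d i) ℂ) :
    Filter.Tendsto (fun ε => redIEC K q ρ ε) Filter.atTop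
      (nhds (max (totalCorr q ρ {A, B}) 0)) := by
  have hpair := fun {t : ℝ} => pair_mem_sublevel_totalCorr_iff (t := t) hAB hparties q ρ
  refine tendsto_integratedEuler _ _ (fun t ht h => ?_) (fun t ht h => ?_) (fun t k ht => ?_)
  · exact redBetti_zero_of_pair_notMem K hAB hparties (singleton_mem_sublevel_totalCorr q ρ ht A)
      (singleton_mem_sublevel_totalCorr q ρ ht B) (mt (hpair ht).1 h.not_ge)
  · exact redBetti_of_pair_mem K hAB hparties ((hpair ht).2 h) 0
  · by_cases he : {A, B} ∈ (sublevel (totalCorr q ρ) t).faces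
    · exact redBetti_of_pair_mem K hAB hparties he _
    · exact redBetti_succ_of_pair_notMem K hparties he k

theorem tendsto_relIEC (hAB : A ≠ B) (hparties : ∀ i, i = A ∨ i = B) (q : ℝ)
    (ρ : Matrix (∀ i, d i) (∀ i, d i) ℂ) :
    Filter.Tendsto (fun ε => relIEC K q ρ {A} ε) Filter.atTop
      (nhds (max (totalCorr q ρ {A, B}) 0)) := by
  have hpair := fun {t : ℝ} => pair_mem_sublevel_totalCorr_iff (t := t) hAB hparties q ρ
  refine tendsto_integratedEuler _ _ (fun t ht h => ?_) (fun t ht h => ?_) (fun t k ht => ?_)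
  · exact relBetti_zero_of_pair_notMem K hAB hparties (singleton_mem_sublevel_totalCorr q ρ ht A)
      (singleton_mem_sublevel_totalCorr q ρ ht B) (mt (hpair ht).1 h.not_ge)
  · exact relBetti_of_pair_mem K hAB hparties ((hpair ht).2 h) 0
  · by_cases he : {A, B} ∈ (sublevel (totalCorr q ρ) t).faces
    · exact relBetti_of_pair_mem K hAB hparties he _
    · exact relBetti_eq_zero_of_isEmpty K _ (isEmpty_simplex_succ hparties he k)

end IEC

end QPH

theorem mainTheorem6 (K : Type*) [Field K] {ι : Type*} [Fintype ι] [LinearOrder ι]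
    {d : ι → Type*} [∀ i, Fintype (d i)] [∀ i, DecidableEq (d i)]
    (A B : ι) (hAB : A ≠ B) (hparties : ∀ i, i = A ∨ i = B)
    (ρ : Matrix (∀ i, d i) (∀ i, d i) ℂ) (hρ : QPH.IsState ρ) :
    ∃ Xrel Xred : ℝ → ℝ,
      (∀ q : ℝ, 1 < q →
        Filter.Tendsto (fun ε => QPH.relIEC K q ρ {A} ε) Filter.atTop (nhds (Xrel q))) ∧
      (∀ q : ℝ, 1 < q →
        Filter.Tendsto (fun ε => QPH.redIEC K q ρ ε) Filter.atTop (nhds (Xred q))) ∧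
      Filter.Tendsto Xrel (nhdsWithin 1 (Set.Ioi 1)) (nhds (QPH.mutualInfo ρ A B)) ∧
      Filter.Tendsto Xred (nhdsWithin 1 (Set.Ioi 1)) (nhds (QPH.mutualInfo ρ A B)) ∧
      0 ≤ QPH.mutualInfo ρ A B := by
  have hI := QPH.mutualInfo_nonneg hAB hparties hρ
  -- The positive part is continuous and fixes the limit, since mutual information is nonnegative.
  have hlim : Filter.Tendsto (fun q => max (QPH.totalCorr q ρ {A, B}) 0)
      (nhdsWithin 1 (Set.Ioi 1)) (nhds (QPH.mutualInfo ρ A B)) := by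
    have h := (QPH.tendsto_totalCorr_pair hAB hρ).max (tendsto_const_nhds (x := (0 : ℝ)))
    rwa [max_eq_left hI] at h
  exact ⟨_, _, fun q _ => QPH.tendsto_relIEC K hAB hparties q ρ,
    fun q _ => QPH.tendsto_redIEC K hAB hparties q ρ, hlim, hlim, hI⟩
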